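/- Let $K$ be an algebraically closed field of characteristic zero, and let $f\in K[X_0,X_1,X_2]$ be a ternary quartic, i.e. a homogeneous polynomial of degree $4$ (possibly zero). For $s,g\in K[X_0,X_1,X_2]$ let $s\lrcorner g:=s\!\left(\frac{\partial}{\partial X_0},\frac{\partial}{\partial X_1},\frac{\partial}{\partial X_2}\right)g$ denote the contraction of $g$ by $s$, i.e. $s$ acts on $g$ as a differential operator with constant coefficients. Let the rank $\operatorname{rk} f$ be the minimum number $r$ of summands in an expression $f=\ell_1^4+\cdots+\ell_r^4$ with $\ell_1,\dots,\ell_r$ linear forms in $X_0,X_1,X_2$. If there exist linearly independent linear forms $x^0,x^1,x^2\in K[X_0,X_1,X_2]$ such that $x^0x^1x^2\lrcorner f=0$ (product of the three forms, the superscripts being indices), then $\operatorname{rk} f\le 7$. -/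

import Mathlib

open MvPolynomial

/-- The contraction `s ⌟ f` of polynomials in the same number of variables: `s` acts on `f` as a
differential operator with constant coefficients, the variable `X i` of `s` acting as `∂/∂(X i)`.
It is the bilinear map with `X^m ⌟ X^n = (∏ i, n_i (n_i - 1) ⋯ (n_i - m_i + 1)) X^(n - m)`; the
coefficient vanishes unless `m ≤ n`. -/
noncomputable def contraction {σ K : Type*} [Fintype σ] [Field K] :
    MvPolynomial σ K →ₗ[K] MvPolynomial σ K →ₗ[K] MvPolynomial σ K :=
  (basisMonomials σ K).constr K fun m =>
    (basisMonomials σ K).constr K fun n =>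
      monomial (n - m) (((∏ i, (n i).descFactorial (m i) : ℕ)) : K)

theorem contraction_monomial {σ K : Type*} [Fintype σ] [Field K] (m n : σ →₀ ℕ) (a b : K) :
    contraction (monomial m a) (monomial n b) =
      monomial (n - m) (a * b * ((∏ i, (n i).descFactorial (m i) : ℕ) : K)) := by
  have key : contraction (monomial m (1 : K)) (monomial n (1 : K)) =
      monomial (n - m) ((∏ i, (n i).descFactorial (m i) : ℕ) : K) := by
    have h (k : σ →₀ ℕ) : monomial k (1 : K) = basisMonomials σ K k := by simp
    rw [h m, h n, contraction, Module.Basis.constr_basis, Module.Basis.constr_basis]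
  have h (k : σ →₀ ℕ) (c : K) : monomial k c = c • monomial k (1 : K) := by
    simp [smul_monomial]
  rw [h m a, h n b, map_smul, map_smul, LinearMap.smul_apply, key]
  simp [smul_monomial, mul_assoc, mul_left_comm]

/-- Variables act as partial derivatives. -/
theorem contraction_X {σ K : Type*} [Fintype σ] [Field K] (i : σ) (f : MvPolynomial σ K) :
    contraction (X i) f = pderiv i f := by
  classical
  induction f using MvPolynomial.induction_on' with
  | monomial n b =>
    rw [pderiv_monomial, X, contraction_monomial, one_mul]
    congr 2
    rw [Finset.prod_eq_single i]
    · simp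
    · intro j _ hj
      simp [Finsupp.single_eq_of_ne hj]
    · simp
  | add p q hp hq => rw [map_add, map_add, hp, hq]

/-- Scalars act by multiplication. -/
theorem contraction_C {σ K : Type*} [Fintype σ] [Field K] (a : K) (f : MvPolynomial σ K) :
    contraction (C a) f = a • f := by
  induction f using MvPolynomial.induction_on' with
  | monomial n b =>
    rw [← monomial_zero', contraction_monomial]
    simp [smul_monomial]
  | add p q hp hq => rw [map_add, smul_add, hp, hq]

/-- Products act by composition. -/
theorem contraction_mul {σ K : Type*} [Fintype σ] [Field K] (s t f : MvPolynomial σ K) :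
    contraction (s * t) f = contraction s (contraction t f) := by
  have hd (n a b : ℕ) :
      n.descFactorial (a + b) = n.descFactorial b * (n - b).descFactorial a := by
    induction a with
    | zero => simp
    | succ a ih =>
      rw [show a + 1 + b = (a + b) + 1 by ring, Nat.descFactorial_succ, ih,
        Nat.descFactorial_succ, show n - (a + b) = n - b - a by omega]
      ring
  induction s using MvPolynomial.induction_on' with
  | add p q hp hq => simp only [add_mul, map_add, LinearMap.add_apply, hp, hq]
  | monomial m a =>
    induction t using MvPolynomial.induction_on' with
    | add p q hp hq => simp only [mul_add, map_add, LinearMap.add_apply, hp, hq]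
    | monomial m' b =>
      induction f using MvPolynomial.induction_on' with
      | add p q hp hq => simp only [map_add, hp, hq]
      | monomial n c =>
        rw [monomial_mul, contraction_monomial, contraction_monomial, contraction_monomial,
          show n - (m + m') = n - m' - m by rw [add_comm, tsub_tsub]]
        congr 1
        simp only [Finsupp.add_apply, Finsupp.tsub_apply, hd, Finset.prod_mul_distrib]
        push_cast
        ring

/-- The (Waring) rank of a form `f` of degree `d`: the minimum number of summands needed to express
`f` as a sum of `d`-th powers of linear forms (`⊤` if there is no such expression). -/
noncomputable def waringRank {σ K : Type*} [Field K] (d : ℕ) (f : MvPolynomial σ K) : ℕ∞ :=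
  sInf {r : ℕ∞ | ∃ (k : ℕ) (l : Fin k → MvPolynomial σ K),
    (∀ i, (l i).IsHomogeneous 1) ∧ f = ∑ i, l i ^ d ∧ r = k}

/-!
The linear forms `x 0, x 1, x 2` are the coordinates of a suitable linear change of variables, after
which the hypothesis reads `∂₀ ∂₁ ∂₂ f = 0` (`pderiv_aeval`). So `f` has no monomial divisible by
`X 0 * X 1 * X 2` and is a sum of three binary quartics, one for each side of the triangle of
coordinate points (`exists_triangle_form`). The pure powers `X i ^ 4` can be moved freely between
the two sides meeting at a vertex, so only the mixed coefficients `a₁, a₂, a₃` of a side matter.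

* If `a₁ a₃ ≠ a₂²` (a regular side), the pure powers can be chosen, in a one-parameter family, such
  that the side becomes a sum of two fourth powers: the first coefficient can be almost any scalar
  `t`, and it determines the last one as a nonconstant function of `t` (`exists_completion`).
* If `a₁ a₃ = a₂²`, the side is at most one fourth power up to pure powers (a degenerate side),
  unless it is a nonzero multiple of `x³ y` or `x y³` (an irregular side).
* `α x⁴ + 4 x³ y + β y⁴` is a sum of three fourth powers for all `α` and all `β ≠ 0`
  (`isSumFourthPowers_three`).

Without irregular sides one counts: three regular sides cost `2 + 2 + 2`, and the free parameters
are used to make the pure powers match at two of the three vertices, so that one more summand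
suffices. One degenerate and two regular sides cost `1 + 2 + 2`, and a match at the vertex opposite
to the degenerate side leaves two pure powers. With two degenerate sides no match is needed.

If there is an irregular side `x³ y`, then replacing `y` by `y - p z` preserves the shape of `f`, and
for almost every `p` it makes the two other sides regular. Matched at `z`, these give
`3 + 2 + 2` summands without any remainder, as the irregular side absorbs arbitrary multiples of
`x⁴` and arbitrary nonzero multiples of `y⁴`. The exceptions, where one of the two sides is regular
for no `p`, are very special quartics for which some substitution of the same kind gives seven
summands at once (`isSumFourthPowers_of_irregular`).
-/

open Filter

/-! ### Sums of fourth powers -/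

section SumFourthPowers

variable {K R : Type*} [Field K] [CommRing R] [Algebra K R] {V : Submodule K R}

/-- `f` is a sum of `n` fourth powers of elements of the space `V`, whose elements play the role of
linear forms. Some of the summands may vanish. -/
def IsSumFourthPowers (V : Submodule K R) (n : ℕ) (f : R) : Prop :=
  ∃ l : Fin n → R, (∀ i, l i ∈ V) ∧ f = ∑ i, l i ^ 4

theorem IsSumFourthPowers.zero (n : ℕ) : IsSumFourthPowers V n 0 :=
  ⟨fun _ => 0, fun _ => V.zero_mem, by simp⟩

theorem IsSumFourthPowers.add {m n : ℕ} {f g : R} (hf : IsSumFourthPowers V m f)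
    (hg : IsSumFourthPowers V n g) : IsSumFourthPowers V (m + n) (f + g) := by
  obtain ⟨l, hl, rfl⟩ := hf
  obtain ⟨k, hk, rfl⟩ := hg
  refine ⟨Fin.append l k, fun i => ?_, by simp [Fin.sum_univ_add]⟩
  refine Fin.addCases (fun i => ?_) (fun i => ?_) i
  · simpa using hl i
  · simpa using hk i

theorem IsSumFourthPowers.mono {m n : ℕ} {f : R} (hf : IsSumFourthPowers V m f) (h : m ≤ n) :
    IsSumFourthPowers V n f := by
  obtain ⟨k, rfl⟩ := Nat.exists_eq_add_of_le h
  simpa using hf.add (.zero k)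

theorem isSumFourthPowers_smul_pow [IsAlgClosed K] (c : K) {v : R} (hv : v ∈ V) :
    IsSumFourthPowers V 1 (c • v ^ 4) := by
  obtain ⟨d, rfl⟩ := IsAlgClosed.exists_pow_nat_eq c (n := 4) (by norm_num)
  exact ⟨fun _ => d • v, fun _ => V.smul_mem _ hv, by simp [smul_pow]⟩

end SumFourthPowers

/-! ### Binary quartics -/

section BinaryQuartic

variable {K R : Type*} [Field K] [CommRing R] [Algebra K R] {V : Submodule K R}

/-- The binary quartic in `x` and `y` with coefficients `a₀, …, a₄`, weighted by binomial
coefficients. -/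
def binaryQuartic (a₀ a₁ a₂ a₃ a₄ : K) (x y : R) : R :=
  a₀ • x ^ 4 + (4 * a₁) • (x ^ 3 * y) + (6 * a₂) • (x ^ 2 * y ^ 2) + (4 * a₃) • (x * y ^ 3) +
    a₄ • y ^ 4

theorem binaryQuartic_swap (a₀ a₁ a₂ a₃ a₄ : K) (x y : R) :
    binaryQuartic a₀ a₁ a₂ a₃ a₄ x y = binaryQuartic a₄ a₃ a₂ a₁ a₀ y x := by
  simp only [binaryQuartic, Algebra.smul_def]
  ring

theorem binaryQuartic_add (a₀ a₁ a₂ a₃ a₄ b₀ b₁ b₂ b₃ b₄ : K) (x y : R) :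
    binaryQuartic a₀ a₁ a₂ a₃ a₄ x y + binaryQuartic b₀ b₁ b₂ b₃ b₄ x y =
      binaryQuartic (a₀ + b₀) (a₁ + b₁) (a₂ + b₂) (a₃ + b₃) (a₄ + b₄) x y := by
  simp only [binaryQuartic, Algebra.smul_def, map_add, map_mul]
  ring

theorem smul_pow_four_eq_binaryQuartic (c r : K) (x y : R) :
    c • (r • x + y) ^ 4 =
      binaryQuartic (c * r ^ 4) (c * r ^ 3) (c * r ^ 2) (c * r) c x y := by
  simp only [binaryQuartic, Algebra.smul_def, map_mul, map_pow, map_ofNat]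
  ring

/-- Changing the coefficients of the pure powers `x ^ 4` and `y ^ 4`. -/
theorem binaryQuartic_eq_add_pure (a₀ a₁ a₂ a₃ a₄ s t : K) (x y : R) :
    binaryQuartic a₀ a₁ a₂ a₃ a₄ x y =
      binaryQuartic s a₁ a₂ a₃ t x y + (a₀ - s) • x ^ 4 + (a₄ - t) • y ^ 4 := by
  simp only [binaryQuartic, Algebra.smul_def, map_sub]
  ring

theorem eventually_cubic_ne_zero (a b c d : K) (h : a ≠ 0 ∨ b ≠ 0 ∨ c ≠ 0 ∨ d ≠ 0) :
    ∀ᶠ t in cofinite, a * t ^ 3 + b * t ^ 2 + c * t + d ≠ 0 := by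
  have hp : (Cubic.toPoly ⟨a, b, c, d⟩ : Polynomial K) ≠ 0 := by
    intro h0
    have := (Cubic.toPoly_eq_zero_iff _).mp h0
    rcases h with h | h | h | h
    · exact h (congrArg Cubic.a this)
    · exact h (congrArg Cubic.b this)
    · exact h (congrArg Cubic.c this)
    · exact h (congrArg Cubic.d this)
  refine (Polynomial.finite_setOfPred_isRoot hp).subset fun t ht => ?_
  simpa [Cubic.toPoly] using ht

/-- Apolarity for binary quartics and binary quadrics: if the operator `u ∂x² + v ∂x ∂y + w ∂y²`
with distinct roots annihilates a binary quartic, then this quartic is a combination of the fourth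
powers of the two linear forms given by the roots. -/
theorem isSumFourthPowers_two_of_recurrence [IsAlgClosed K] [CharZero K]
    {a₀ a₁ a₂ a₃ a₄ u v w : K} (hu : u ≠ 0) (hd : v ^ 2 - 4 * u * w ≠ 0)
    (h₀ : u * a₀ + v * a₁ + w * a₂ = 0) (h₁ : u * a₁ + v * a₂ + w * a₃ = 0)
    (h₂ : u * a₂ + v * a₃ + w * a₄ = 0) {x y : R} (hx : x ∈ V) (hy : y ∈ V) :
    IsSumFourthPowers V 2 (binaryQuartic a₀ a₁ a₂ a₃ a₄ x y) := by
  obtain ⟨δ, hδ⟩ := IsAlgClosed.exists_pow_nat_eq (v ^ 2 - 4 * u * w) (n := 2) (by norm_num)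
  have hδ0 : δ ≠ 0 := by rintro rfl; exact hd (by rw [← hδ]; ring)
  obtain ⟨r, hr⟩ : ∃ r, r = (-v + δ) / (2 * u) := ⟨_, rfl⟩
  obtain ⟨s, hs⟩ : ∃ s, s = (-v - δ) / (2 * u) := ⟨_, rfl⟩
  have hrs : r - s ≠ 0 := by
    have : r - s = δ / u := by rw [hr, hs]; field_simp; ring
    rw [this]; exact div_ne_zero hδ0 hu
  have hv : v = -u * (r + s) := by rw [hr, hs]; field_simp; ring
  have hw : w = u * (r * s) := by
    have : w = (v ^ 2 - δ ^ 2) / (4 * u) := by rw [hδ]; field_simp; ring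
    rw [this, hr, hs]; field_simp; ring
  subst hv hw
  have e₂ : a₂ = (r + s) * a₃ - r * s * a₄ := by
    apply mul_left_cancel₀ hu; linear_combination h₂
  have e₁ : a₁ = (r + s) * a₂ - r * s * a₃ := by
    apply mul_left_cancel₀ hu; linear_combination h₁
  have e₀ : a₀ = (r + s) * a₁ - r * s * a₂ := by
    apply mul_left_cancel₀ hu; linear_combination h₀
  -- The weights solve `A + B = a₄`, `A r + B s = a₃`; the recurrence gives the rest.
  have key := (isSumFourthPowers_smul_pow ((a₃ - s * a₄) / (r - s))
    (V.add_mem (V.smul_mem r hx) hy)).add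
    (isSumFourthPowers_smul_pow ((r * a₄ - a₃) / (r - s)) (V.add_mem (V.smul_mem s hx) hy))
  rw [smul_pow_four_eq_binaryQuartic, smul_pow_four_eq_binaryQuartic, binaryQuartic_add] at key
  convert key using 2
  · rw [e₀, e₁, e₂]; field_simp; ring
  · rw [e₁, e₂]; field_simp; ring
  · rw [e₂]; field_simp; ring
  · field_simp; ring
  · field_simp; ring

/-- If `a₁ a₃ ≠ a₂²`, then for almost every `t` the quartic with coefficients `t, a₁, a₂, a₃` can
be completed by a last coefficient to a sum of two fourth powers. The last coefficient is a
nonconstant fractional linear function `ψ` of `t`, obtained by making the catalecticant determinant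
vanish. -/
theorem exists_completion [IsAlgClosed K] [CharZero K] (V : Submodule K R) {a₁ a₂ a₃ : K}
    (hD : a₁ * a₃ - a₂ ^ 2 ≠ 0) :
    ∃ ψ : K → K, Tendsto ψ cofinite cofinite ∧ ∀ᶠ t in cofinite, ∀ x ∈ V, ∀ y ∈ V,
      IsSumFourthPowers V 2 (binaryQuartic t a₁ a₂ a₃ (ψ t) x y) := by
  -- The kernel of the catalecticant matrix is spanned by
  -- `(a₁ a₃ - a₂², a₁ a₂ - t a₃, t a₂ - a₁²)`; `hw` makes the last coefficient solvable and `hd`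
  -- says that the corresponding quadric has distinct roots.
  have hw : ∀ᶠ t in cofinite, t * a₂ - a₁ ^ 2 ≠ 0 := by
    have := eventually_cubic_ne_zero 0 0 a₂ (-a₁ ^ 2) (by
      by_contra! h
      apply hD
      have h1 : a₁ = 0 := by simpa using h.2.2.2
      rw [h.2.2.1, h1]; ring)
    filter_upwards [this] with t ht h0
    exact ht (by linear_combination h0)
  have hd : ∀ᶠ t in cofinite, (a₁ * a₂ - t * a₃) ^ 2 -
      4 * (a₁ * a₃ - a₂ ^ 2) * (t * a₂ - a₁ ^ 2) ≠ 0 := by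
    have := eventually_cubic_ne_zero 0 (a₃ ^ 2)
      (-2 * (a₁ * a₂ * a₃) - 4 * (a₁ * a₃ - a₂ ^ 2) * a₂)
      ((a₁ * a₂) ^ 2 + 4 * (a₁ * a₃ - a₂ ^ 2) * a₁ ^ 2) (by
        by_contra! h
        have h3 : a₃ = 0 := by simpa using h.2.1
        apply hD
        have h2 : a₂ = 0 := by
          have := h.2.2.1
          rw [h3] at this
          ring_nf at this
          simpa using this
        rw [h2, h3]; ring)
    filter_upwards [this] with t ht h0
    exact ht (by linear_combination h0)
  refine ⟨fun t => -((a₁ * a₃ - a₂ ^ 2) * a₂ + (a₁ * a₂ - t * a₃) * a₃) / (t * a₂ - a₁ ^ 2),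
    ?_, ?_⟩
  · refine Tendsto.cofinite_of_finite_preimage_singleton fun s => ?_
    suffices h : ∀ᶠ t in cofinite,
        -((a₁ * a₃ - a₂ ^ 2) * a₂ + (a₁ * a₂ - t * a₃) * a₃) / (t * a₂ - a₁ ^ 2) ≠ s by
      refine Set.Finite.subset h fun t ht => ?_
      simpa using ht
    have := eventually_cubic_ne_zero 0 0 (a₂ * s - a₃ ^ 2)
      (2 * a₁ * a₂ * a₃ - a₁ ^ 2 * s - a₂ ^ 3) (by
        by_contra! h
        obtain ⟨-, -, hA, hB⟩ := h
        have : (a₁ * a₃ - a₂ ^ 2) ^ 2 = 0 := by linear_combination (-a₁ ^ 2) * hA - a₂ * hB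
        exact hD (by simpa using this))
    filter_upwards [this, hw] with t ht hwt h0
    rw [div_eq_iff hwt] at h0
    exact ht (by linear_combination -h0)
  · filter_upwards [hw, hd] with t hwt hdt x hx y hy
    refine isSumFourthPowers_two_of_recurrence (u := a₁ * a₃ - a₂ ^ 2) (v := a₁ * a₂ - t * a₃)
      (w := t * a₂ - a₁ ^ 2) hD hdt (by ring) (by ring) ?_ hx hy
    rw [mul_div_cancel₀ _ hwt]
    ring

/-- If `a₁ a₃ = a₂²`, a quartic is a single fourth power (possibly zero) up to the pure powers,
unless its mixed part is a nonzero multiple of `x ^ 3 * y` or of `x * y ^ 3`. -/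
theorem exists_completion_of_eq_zero [IsAlgClosed K] (V : Submodule K R) {a₁ a₂ a₃ : K}
    (hD : a₁ * a₃ - a₂ ^ 2 = 0) (h₁ : a₂ = 0 → a₁ = 0) (h₃ : a₂ = 0 → a₃ = 0) :
    ∃ s t : K, ∀ x ∈ V, ∀ y ∈ V, IsSumFourthPowers V 1 (binaryQuartic s a₁ a₂ a₃ t x y) := by
  by_cases h2 : a₂ = 0
  · refine ⟨0, 0, fun x _ y _ => ?_⟩
    simpa [h₁ h2, h2, h₃ h2, binaryQuartic] using IsSumFourthPowers.zero (V := V) 1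
  · have h3 : a₃ ≠ 0 := by
      rintro rfl
      exact h2 (by simpa using hD)
    refine ⟨a₃ ^ 2 / a₂ * (a₂ / a₃) ^ 4, a₃ ^ 2 / a₂, fun x hx y hy => ?_⟩
    have := isSumFourthPowers_smul_pow (a₃ ^ 2 / a₂) (V.add_mem (V.smul_mem (a₂ / a₃) hx) hy)
    rw [smul_pow_four_eq_binaryQuartic] at this
    convert this using 2
    · field_simp; linear_combination hD
    · field_simp
    · field_simp

/-- The quartic `α x⁴ + 4 x³ y + β y⁴` with `β ≠ 0` is apolar to every binary cubic whose roots have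
sum `α` and product `β⁻¹`. A cubic with three distinct roots exists among these. -/
theorem isSumFourthPowers_three [IsAlgClosed K] [CharZero K] (α : K) {β : K} (hβ : β ≠ 0)
    {x y : R} (hx : x ∈ V) (hy : y ∈ V) :
    IsSumFourthPowers V 3 (binaryQuartic α 1 0 0 β x y) := by
  -- The roots are `t` and the roots `r`, `s` of a quadratic determined by `t`. The conditions say
  -- that its discriminant does not vanish and that `t` is not one of its roots.
  have E1 := eventually_cubic_ne_zero 1 (-2 * α) (α ^ 2) (-4 * β⁻¹) (by simp)
  have E2 := eventually_cubic_ne_zero 2 (-α) 0 β⁻¹ (by simp)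
  have E3 := eventually_cubic_ne_zero (0 : K) 0 1 0 (by simp)
  obtain ⟨t, h1, h2, h3⟩ := (E1.and (E2.and E3)).exists
  have ht : t ≠ 0 := by simpa using h3
  obtain ⟨δ, hδ⟩ := IsAlgClosed.exists_pow_nat_eq ((α - t) ^ 2 - 4 * (β⁻¹ / t)) (n := 2)
    (by norm_num)
  have hδ0 : δ ≠ 0 := by
    rintro rfl
    apply h1
    have h4 : (α - t) ^ 2 - 4 * (β⁻¹ / t) = 0 := by rw [← hδ]; ring
    have h5 : t * (β⁻¹ / t) = β⁻¹ := by field_simp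
    linear_combination t * h4 + 4 * h5
  obtain ⟨r, hr⟩ : ∃ r, r = (α - t + δ) / 2 := ⟨_, rfl⟩
  obtain ⟨s, hs⟩ : ∃ s, s = (α - t - δ) / 2 := ⟨_, rfl⟩
  have hsum : α = t + r + s := by rw [hr, hs]; field_simp; ring
  have hprod : β * (t * r * s) = 1 := by
    have h4 : r * s = β⁻¹ / t := by
      have : r * s = ((α - t) ^ 2 - δ ^ 2) / 4 := by rw [hr, hs]; field_simp; ring
      rw [this, hδ]; field_simp; ring
    rw [mul_assoc t, h4]; field_simp
  have hβ' : β⁻¹ = t * r * s := by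
    rw [inv_eq_iff_eq_inv]; exact eq_inv_of_mul_eq_one_left hprod
  have hrs : r - s ≠ 0 := by
    have : r - s = δ := by rw [hr, hs]; field_simp; ring
    rwa [this]
  have htt : (t - r) * (t - s) ≠ 0 := by
    intro h0
    apply h2
    rw [hβ', hsum]
    linear_combination t * h0
  have htr : t - r ≠ 0 := left_ne_zero_of_mul htt
  have hts : t - s ≠ 0 := right_ne_zero_of_mul htt
  -- Lagrange interpolation: the weights have moments `β, 0, 0` of orders `0, 1, 2`.
  have key := ((isSumFourthPowers_smul_pow (β * (r * s) / ((t - r) * (t - s)))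
    (V.add_mem (V.smul_mem t hx) hy)).add
    (isSumFourthPowers_smul_pow (-(β * (t * s)) / ((t - r) * (r - s)))
    (V.add_mem (V.smul_mem r hx) hy))).add
    (isSumFourthPowers_smul_pow (β * (t * r) / ((t - s) * (r - s)))
    (V.add_mem (V.smul_mem s hx) hy))
  simp only [smul_pow_four_eq_binaryQuartic, binaryQuartic_add] at key
  convert key using 2
  · field_simp; rw [hsum]
    linear_combination (-(t + r + s) * (t - r) * (t - s) * (r - s)) * hprod
  · field_simp
    linear_combination (-(t - r) * (t - s) * (r - s)) * hprod
  · field_simp; ring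
  · field_simp; ring
  · field_simp; ring

end BinaryQuartic

section Completion

variable {K R : Type*} [Field K] [CommRing R] [Algebra K R] {V : Submodule K R}

/-- The version of `exists_completion` in which the last coefficient is prescribed. -/
theorem exists_completion' [IsAlgClosed K] [CharZero K] (V : Submodule K R) {a₁ a₂ a₃ : K}
    (hD : a₁ * a₃ - a₂ ^ 2 ≠ 0) :
    ∃ ψ : K → K, Tendsto ψ cofinite cofinite ∧ ∀ᶠ t in cofinite, ∀ x ∈ V, ∀ y ∈ V,
      IsSumFourthPowers V 2 (binaryQuartic (ψ t) a₁ a₂ a₃ t x y) := by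
  obtain ⟨ψ, hψ, h⟩ := exists_completion V (a₁ := a₃) (a₂ := a₂) (a₃ := a₁)
    (by rwa [mul_comm a₃ a₁])
  refine ⟨ψ, hψ, h.mono fun t ht x hx y hy => ?_⟩
  rw [binaryQuartic_swap]
  exact ht y hy x hx

/-- The case of three summands, with an arbitrary nonzero coefficient of `x ^ 3 * y`. -/
theorem isSumFourthPowers_three' [IsAlgClosed K] [CharZero K] (α : K) {a β : K} (ha : a ≠ 0)
    (hβ : β ≠ 0) {x y : R} (hx : x ∈ V) (hy : y ∈ V) :
    IsSumFourthPowers V 3 (binaryQuartic α a 0 0 β x y) := by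
  have := isSumFourthPowers_three (V := V) α (β := β / a ^ 4) (div_ne_zero hβ (pow_ne_zero 4 ha))
    hx (V.smul_mem a hy)
  convert this using 1
  simp only [binaryQuartic, smul_pow, mul_smul_comm, smul_smul]
  have : β / a ^ 4 * a ^ 4 = β := by field_simp
  simp [this]

/-- Classification of the mixed coefficients `a₁, a₂, a₃` of a binary quartic. The four cases are
called below regular, degenerate, and irregular, the last two being `x ^ 3 * y` and `x * y ^ 3`. -/
theorem binaryQuartic_classification [IsAlgClosed K] (V : Submodule K R) (a₁ a₂ a₃ : K) :
    a₁ * a₃ - a₂ ^ 2 ≠ 0 ∨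
    (∃ s t : K, ∀ x ∈ V, ∀ y ∈ V, IsSumFourthPowers V 1 (binaryQuartic s a₁ a₂ a₃ t x y)) ∨
    (a₁ ≠ 0 ∧ a₂ = 0 ∧ a₃ = 0) ∨ (a₁ = 0 ∧ a₂ = 0 ∧ a₃ ≠ 0) := by
  by_cases hD : a₁ * a₃ - a₂ ^ 2 = 0
  · by_cases h₁ : a₂ = 0 → a₁ = 0
    · by_cases h₃ : a₂ = 0 → a₃ = 0
      · exact .inr (.inl (exists_completion_of_eq_zero V hD h₁ h₃))
      · push Not at h₃
        exact .inr (.inr (.inr ⟨h₁ h₃.1, h₃⟩))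
    · push Not at h₁
      refine .inr (.inr (.inl ⟨h₁.2, h₁.1, ?_⟩))
      simpa [h₁.1, h₁.2] using hD
  · exact .inl hD

/-- Every binary quartic has rank at most four. -/
theorem isSumFourthPowers_four [IsAlgClosed K] [CharZero K] (a₀ a₁ a₂ a₃ a₄ : K) {x y : R}
    (hx : x ∈ V) (hy : y ∈ V) :
    IsSumFourthPowers V 4 (binaryQuartic a₀ a₁ a₂ a₃ a₄ x y) := by
  have irregular (a₀ a₁ a₄ : K) (h : a₁ ≠ 0) {x y : R} (hx : x ∈ V) (hy : y ∈ V) :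
      IsSumFourthPowers V 4 (binaryQuartic a₀ a₁ 0 0 a₄ x y) := by
    rw [binaryQuartic_eq_add_pure _ _ _ _ _ a₀ 1, sub_self, zero_smul, add_zero]
    exact (isSumFourthPowers_three' a₀ h one_ne_zero hx hy).add (isSumFourthPowers_smul_pow _ hy)
  rcases binaryQuartic_classification V a₁ a₂ a₃ with hD | ⟨s, t, h⟩ | ⟨h, rfl, rfl⟩ | ⟨rfl, rfl, h⟩
  · obtain ⟨ψ, -, h⟩ := exists_completion V hD
    obtain ⟨t, ht⟩ := h.exists
    rw [binaryQuartic_eq_add_pure _ _ _ _ _ t (ψ t)]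
    exact ((ht x hx y hy).add (isSumFourthPowers_smul_pow _ hx)).add
      (isSumFourthPowers_smul_pow _ hy)
  · rw [binaryQuartic_eq_add_pure _ _ _ _ _ s t]
    exact (((h x hx y hy).add (isSumFourthPowers_smul_pow _ hx)).add
      (isSumFourthPowers_smul_pow _ hy)).mono (by norm_num)
  · exact irregular _ _ _ h hx hy
  · rw [binaryQuartic_swap]
    exact irregular _ _ _ h hy hx

end Completion

/-! ### Sums of binary quartics on the sides of a triangle -/

section Triangle

variable {K R : Type*} [Field K] [IsAlgClosed K] [CommRing R] [Algebra K R]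
  {V : Submodule K R} {x y z : R}

variable {a₀ a₁ a₂ a₃ a₄ b₀ b₁ b₂ b₃ b₄ c₀ c₁ c₂ c₃ c₄ : K}

/-- Two degenerate sides cost one summand each, and the third side, not being irregular, at most
two. At most three pure powers remain. -/
theorem isSumFourthPowers_of_degenerate_degenerate
    (ha : ∃ s t : K, ∀ x ∈ V, ∀ y ∈ V, IsSumFourthPowers V 1 (binaryQuartic s a₁ a₂ a₃ t x y))
    (hb : ∃ s t : K, ∀ x ∈ V, ∀ y ∈ V, IsSumFourthPowers V 1 (binaryQuartic s b₁ b₂ b₃ t x y))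
    (hc : ∃ s t : K, ∀ x ∈ V, ∀ y ∈ V, IsSumFourthPowers V 2 (binaryQuartic s c₁ c₂ c₃ t x y))
    (hx : x ∈ V) (hy : y ∈ V) (hz : z ∈ V) :
    IsSumFourthPowers V 7 (binaryQuartic a₀ a₁ a₂ a₃ a₄ x y + binaryQuartic b₀ b₁ b₂ b₃ b₄ y z +
      binaryQuartic c₀ c₁ c₂ c₃ c₄ z x) := by
  obtain ⟨a, a', ha⟩ := ha
  obtain ⟨b, b', hb⟩ := hb
  obtain ⟨c, c', hc⟩ := hc
  have := (((((ha x hx y hy).add (hb y hy z hz)).add (hc z hz x hx)).add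
    (isSumFourthPowers_smul_pow (a₀ + c₄ - a - c') hx)).add
    (isSumFourthPowers_smul_pow (b₀ + a₄ - b - a') hy)).add
    (isSumFourthPowers_smul_pow (c₀ + b₄ - c - b') hz)
  convert this using 1
  simp only [binaryQuartic, Algebra.smul_def, map_add, map_sub, map_mul, map_ofNat]
  ring

variable [CharZero K]

theorem tendsto_const_sub_cofinite {K : Type*} [Field K] (c : K) :
    Tendsto (fun t : K => c - t) cofinite cofinite :=
  (sub_right_injective (b := c)).tendsto_cofinite

/-- One irregular side and two regular ones. The completions of the regular sides are matched at
`z`; the irregular side absorbs any coefficient of `x ^ 4` and any nonzero one of `y ^ 4`. -/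
theorem isSumFourthPowers_of_irregular_regular_regular {a : K} (ha : a ≠ 0)
    {n₀ n₁ n₂ n₃ n₄ k₀ k₁ k₂ k₃ k₄ : K} (hn : n₁ * n₃ - n₂ ^ 2 ≠ 0) (hk : k₁ * k₃ - k₂ ^ 2 ≠ 0)
    (hx : x ∈ V) (hy : y ∈ V) (hz : z ∈ V) :
    IsSumFourthPowers V 7 ((4 * a) • (x ^ 3 * y) + binaryQuartic n₀ n₁ n₂ n₃ n₄ y z +
      binaryQuartic k₀ k₁ k₂ k₃ k₄ x z) := by
  obtain ⟨φ, hφ, h⟩ := exists_completion' V hn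
  obtain ⟨ψ, -, h'⟩ := exists_completion' V hk
  have hT := tendsto_const_sub_cofinite (n₄ + k₄)
  obtain ⟨t, ht, ht', hne⟩ := ((hT.eventually h).and (h'.and ((hφ.comp hT).eventually
    (eventually_cofinite_ne n₀)))).exists
  have := ((ht y hy z hz).add (ht' x hx z hz)).add (isSumFourthPowers_three' (k₀ - ψ t) ha
    (sub_ne_zero.mpr hne.symm) hx hy)
  convert this using 1
  simp only [binaryQuartic, Algebra.smul_def, map_add, map_sub, map_mul, map_ofNat, map_zero,
    Function.comp_apply]
  ring

/-- One irregular side. Replacing `y` by `y - p * z` keeps the shape of the quartic, and makes the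
two other sides regular for almost every `p`, apart from exceptions treated directly. -/
theorem isSumFourthPowers_of_irregular {a : K} (ha : a ≠ 0)
    (n₀ n₁ n₂ n₃ n₄ k₀ k₁ k₂ k₃ k₄ : K) (hx : x ∈ V) (hy : y ∈ V) (hz : z ∈ V) :
    IsSumFourthPowers V 7 ((4 * a) • (x ^ 3 * y) + binaryQuartic n₀ n₁ n₂ n₃ n₄ y z +
      binaryQuartic k₀ k₁ k₂ k₃ k₄ x z) := by
  have hyz (p : K) : y - p • z ∈ V := V.sub_mem hy (V.smul_mem p hz)
  have shear (p : K) : (4 * a) • (x ^ 3 * y) + binaryQuartic n₀ n₁ n₂ n₃ n₄ y z +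
      binaryQuartic k₀ k₁ k₂ k₃ k₄ x z = (4 * a) • (x ^ 3 * (y - p • z)) +
      binaryQuartic n₀ (n₁ + n₀ * p) (n₂ + 2 * n₁ * p + n₀ * p ^ 2)
        (n₃ + 3 * n₂ * p + 3 * n₁ * p ^ 2 + n₀ * p ^ 3)
        (n₄ + 4 * n₃ * p + 6 * n₂ * p ^ 2 + 4 * n₁ * p ^ 3 + n₀ * p ^ 4) (y - p • z) z +
      binaryQuartic k₀ (k₁ + a * p) k₂ k₃ k₄ x z := by
    simp only [binaryQuartic, Algebra.smul_def, map_add, map_mul, map_pow, map_ofNat]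
    ring
  by_cases hk : k₂ = 0 ∧ k₃ = 0
  · -- The irregular terms combine to `4 x³ w`, where `w = a y + k₁ z`.
    obtain ⟨rfl, rfl⟩ := hk
    have := (isSumFourthPowers_three k₀ one_ne_zero hx
      (V.add_mem (V.smul_mem a hy) (V.smul_mem k₁ hz))).add (isSumFourthPowers_four
      (n₀ - a ^ 4) (n₁ - a ^ 3 * k₁) (n₂ - a ^ 2 * k₁ ^ 2) (n₃ - a * k₁ ^ 3)
      (n₄ + k₄ - k₁ ^ 4) hy hz)
    convert this using 1
    simp only [binaryQuartic, Algebra.smul_def, map_add, map_sub, map_mul, map_pow, map_ofNat,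
      map_zero, map_one]
    ring
  have hkp : ∀ᶠ p in cofinite, (k₁ + a * p) * k₃ - k₂ ^ 2 ≠ 0 := by
    have := eventually_cubic_ne_zero 0 0 (a * k₃) (k₁ * k₃ - k₂ ^ 2) (by
      by_contra! h
      have h3 : k₃ = 0 := by simpa [ha] using h.2.2.1
      exact hk ⟨by simpa [h3] using h.2.2.2, h3⟩)
    filter_upwards [this] with p hp h0
    exact hp (by linear_combination h0)
  by_cases hn : n₀ * n₂ - n₁ ^ 2 = 0 ∧ n₀ * n₃ - n₁ * n₂ = 0 ∧ n₁ * n₃ - n₂ ^ 2 = 0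
  swap
  · -- As a function of `p`, the determinant of the side `y, z` is the Hessian of the binary cubic
    -- with coefficients `n₀, n₁, n₂, n₃`.
    have hnp := eventually_cubic_ne_zero 0 (n₀ * n₂ - n₁ ^ 2) (n₀ * n₃ - n₁ * n₂)
      (n₁ * n₃ - n₂ ^ 2) (by tauto)
    obtain ⟨p, hp, hp'⟩ := (hnp.and hkp).exists
    rw [shear p]
    refine isSumFourthPowers_of_irregular_regular_regular ha (fun h0 => hp ?_) hp' hx (hyz p) hz
    linear_combination h0
  obtain ⟨e₁, e₂, e₃⟩ := hn
  by_cases h0 : n₀ = 0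
  · subst h0
    have h1 : n₁ = 0 := by simpa using e₁
    subst h1
    have h2 : n₂ = 0 := by simpa using e₃
    subst h2
    by_cases h3 : n₃ = 0
    · -- The side `y, z` is a multiple of `z⁴`; the shear makes the side `x, z` regular.
      subst h3
      obtain ⟨p, hp⟩ := hkp.exists
      obtain ⟨ψ, -, h⟩ := exists_completion V hp
      obtain ⟨t, ht⟩ := h.exists
      have := (((ht x hx z hz).add (isSumFourthPowers_three' (k₀ - t) ha one_ne_zero hx
        (hyz p))).add (isSumFourthPowers_smul_pow (-1) (hyz p))).add
        (isSumFourthPowers_smul_pow (k₄ + n₄ - ψ t) hz)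
      rw [shear p]
      convert this using 1
      simp only [binaryQuartic, Algebra.smul_def, map_add, map_sub, map_mul, map_pow, map_ofNat,
        map_zero, map_one, map_neg]
      ring
    · -- With `w = y - q x - p z` the sides `x, w` and `z, w` are irregular, and `p`, `q` can be
      -- chosen such that the third side becomes `k₂ (x + z)⁴`, up to the pure powers.
      obtain ⟨p, rfl⟩ : ∃ p, k₁ = k₂ - a * p := ⟨(k₂ - k₁) / a, by field_simp; ring⟩
      obtain ⟨q, rfl⟩ : ∃ q, k₃ = k₂ - n₃ * q := ⟨(k₂ - k₃) / n₃, by field_simp; ring⟩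
      have hw : y - p • z - q • x ∈ V := V.sub_mem (hyz p) (V.smul_mem q hx)
      have := ((isSumFourthPowers_three' (k₀ + 4 * a * q - k₂) ha one_ne_zero hx hw).add
        (isSumFourthPowers_three' (k₄ + n₄ + 4 * n₃ * p - k₂) h3 (neg_ne_zero.mpr one_ne_zero)
        hz hw)).add (isSumFourthPowers_smul_pow k₂ (V.add_mem hx hz))
      convert this using 1
      simp only [binaryQuartic, Algebra.smul_def, map_add, map_sub, map_mul, map_ofNat,
        map_zero, map_one, map_neg]
      ring
  · -- The side `y, z` is `n₀ (y - p z)⁴` up to the pure power `z⁴`.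
    obtain ⟨p, rfl⟩ : ∃ p, n₁ = -(n₀ * p) := ⟨-(n₁ / n₀), by field_simp⟩
    have h2 : n₂ = n₀ * p ^ 2 := by
      apply mul_left_cancel₀ h0; linear_combination e₁
    subst h2
    have h3 : n₃ = -(n₀ * p ^ 3) := by
      apply mul_left_cancel₀ h0; linear_combination e₂
    subst h3
    have := (isSumFourthPowers_three' 0 ha h0 hx (hyz p)).add (isSumFourthPowers_four k₀
      (k₁ + a * p) k₂ k₃ (k₄ + n₄ - n₀ * p ^ 4) hx hz)
    convert this using 1
    simp only [binaryQuartic, Algebra.smul_def, map_add, map_sub, map_mul, map_pow, map_ofNat,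
      map_zero, map_neg]
    ring

/-- The completions of the two regular sides are matched at their common vertex `z`. -/
theorem isSumFourthPowers_of_degenerate_regular_regular
    (ha : ∃ s t : K, ∀ x ∈ V, ∀ y ∈ V, IsSumFourthPowers V 1 (binaryQuartic s a₁ a₂ a₃ t x y))
    (hb : b₁ * b₃ - b₂ ^ 2 ≠ 0) (hc : c₁ * c₃ - c₂ ^ 2 ≠ 0)
    (hx : x ∈ V) (hy : y ∈ V) (hz : z ∈ V) :
    IsSumFourthPowers V 7 (binaryQuartic a₀ a₁ a₂ a₃ a₄ x y + binaryQuartic b₀ b₁ b₂ b₃ b₄ y z +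
      binaryQuartic c₀ c₁ c₂ c₃ c₄ z x) := by
  obtain ⟨a, a', ha⟩ := ha
  obtain ⟨φ, -, h⟩ := exists_completion' V hb
  obtain ⟨ψ, -, h'⟩ := exists_completion V hc
  obtain ⟨t, ht, ht'⟩ :=
    (h.and ((tendsto_const_sub_cofinite (c₀ + b₄)).eventually h')).exists
  have := ((((ha x hx y hy).add (ht y hy z hz)).add (ht' z hz x hx)).add
    (isSumFourthPowers_smul_pow (a₀ + c₄ - a - ψ (c₀ + b₄ - t)) hx)).add
    (isSumFourthPowers_smul_pow (b₀ + a₄ - φ t - a') hy)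
  convert this using 1
  simp only [binaryQuartic, Algebra.smul_def, map_add, map_sub, map_mul, map_ofNat]
  ring

/-- The completions of three regular sides are matched at the vertices `x` and `y`. -/
theorem isSumFourthPowers_of_regular
    (ha : a₁ * a₃ - a₂ ^ 2 ≠ 0) (hb : b₁ * b₃ - b₂ ^ 2 ≠ 0) (hc : c₁ * c₃ - c₂ ^ 2 ≠ 0)
    (hx : x ∈ V) (hy : y ∈ V) (hz : z ∈ V) :
    IsSumFourthPowers V 7 (binaryQuartic a₀ a₁ a₂ a₃ a₄ x y + binaryQuartic b₀ b₁ b₂ b₃ b₄ y z +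
      binaryQuartic c₀ c₁ c₂ c₃ c₄ z x) := by
  obtain ⟨χ, hχ, h⟩ := exists_completion V ha
  obtain ⟨φ, -, h'⟩ := exists_completion V hb
  obtain ⟨ψ, -, h''⟩ := exists_completion' V hc
  obtain ⟨t, ht, ht', ht''⟩ :=
    (h.and ((((tendsto_const_sub_cofinite (b₀ + a₄)).comp hχ).eventually h').and
    ((tendsto_const_sub_cofinite (a₀ + c₄)).eventually h''))).exists
  have := (((ht x hx y hy).add (ht' y hy z hz)).add (ht'' z hz x hx)).add
    (isSumFourthPowers_smul_pow (c₀ + b₄ - ψ (a₀ + c₄ - t) - φ (b₀ + a₄ - χ t)) hz)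
  convert this using 1
  simp only [binaryQuartic, Algebra.smul_def, map_add, map_sub, map_mul, map_ofNat,
    Function.comp_apply]
  ring

/-- Combines the preceding cases, up to the symmetries of the triangle. -/
theorem isSumFourthPowers_of_triangle (a₀ a₁ a₂ a₃ a₄ b₀ b₁ b₂ b₃ b₄ c₀ c₁ c₂ c₃ c₄ : K)
    (hx : x ∈ V) (hy : y ∈ V) (hz : z ∈ V) :
    IsSumFourthPowers V 7 (binaryQuartic a₀ a₁ a₂ a₃ a₄ x y + binaryQuartic b₀ b₁ b₂ b₃ b₄ y z +
      binaryQuartic c₀ c₁ c₂ c₃ c₄ z x) := by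
  have irregular (a₀ a₁ a₄ b₀ b₁ b₂ b₃ b₄ c₀ c₁ c₂ c₃ c₄ : K) (h : a₁ ≠ 0) {x y z : R}
      (hx : x ∈ V) (hy : y ∈ V) (hz : z ∈ V) :
      IsSumFourthPowers V 7 (binaryQuartic a₀ a₁ 0 0 a₄ x y + binaryQuartic b₀ b₁ b₂ b₃ b₄ y z +
        binaryQuartic c₀ c₁ c₂ c₃ c₄ z x) := by
    convert isSumFourthPowers_of_irregular h (b₀ + a₄) b₁ b₂ b₃ b₄ (c₄ + a₀) c₃ c₂ c₁ c₀
      hx hy hz using 1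
    simp only [binaryQuartic, Algebra.smul_def, map_add, map_mul, map_ofNat, map_zero]
    ring
  have irregular' (a₀ a₃ a₄ b₀ b₁ b₂ b₃ b₄ c₀ c₁ c₂ c₃ c₄ : K) (h : a₃ ≠ 0) {x y z : R}
      (hx : x ∈ V) (hy : y ∈ V) (hz : z ∈ V) :
      IsSumFourthPowers V 7 (binaryQuartic a₀ 0 0 a₃ a₄ x y + binaryQuartic b₀ b₁ b₂ b₃ b₄ y z +
        binaryQuartic c₀ c₁ c₂ c₃ c₄ z x) := by
    rw [add_right_comm, binaryQuartic_swap a₀, binaryQuartic_swap b₀, binaryQuartic_swap c₀]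
    exact irregular _ _ _ _ _ _ _ _ _ _ _ _ _ h hy hx hz
  have degenerate {a₁ a₂ a₃ : K} (h : ∃ s t : K, ∀ x ∈ V, ∀ y ∈ V,
      IsSumFourthPowers V 1 (binaryQuartic s a₁ a₂ a₃ t x y)) : ∃ s t : K, ∀ x ∈ V, ∀ y ∈ V,
      IsSumFourthPowers V 2 (binaryQuartic s a₁ a₂ a₃ t x y) := by
    obtain ⟨s, t, h⟩ := h
    exact ⟨s, t, fun x hx y hy => (h x hx y hy).mono one_le_two⟩
  have regular {a₁ a₂ a₃ : K} (h : a₁ * a₃ - a₂ ^ 2 ≠ 0) : ∃ s t : K, ∀ x ∈ V, ∀ y ∈ V,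
      IsSumFourthPowers V 2 (binaryQuartic s a₁ a₂ a₃ t x y) := by
    obtain ⟨ψ, -, h⟩ := exists_completion V h
    obtain ⟨t, ht⟩ := h.exists
    exact ⟨t, ψ t, ht⟩
  rcases binaryQuartic_classification V a₁ a₂ a₃ with ha | ha | ⟨h, rfl, rfl⟩ | ⟨rfl, rfl, h⟩
  rotate_left 2
  · exact irregular _ _ _ _ _ _ _ _ _ _ _ _ _ h hx hy hz
  · exact irregular' _ _ _ _ _ _ _ _ _ _ _ _ _ h hx hy hz
  all_goals
    rcases binaryQuartic_classification V b₁ b₂ b₃ with hb | hb | ⟨h, rfl, rfl⟩ | ⟨rfl, rfl, h⟩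
    rotate_left 2
    · rw [add_rotate]
      exact irregular _ _ _ _ _ _ _ _ _ _ _ _ _ h hy hz hx
    · rw [add_rotate]
      exact irregular' _ _ _ _ _ _ _ _ _ _ _ _ _ h hy hz hx
  all_goals
    rcases binaryQuartic_classification V c₁ c₂ c₃ with hc | hc | ⟨h, rfl, rfl⟩ | ⟨rfl, rfl, h⟩
    rotate_left 2
    · rw [← add_rotate]
      exact irregular _ _ _ _ _ _ _ _ _ _ _ _ _ h hz hx hy
    · rw [← add_rotate]
      exact irregular' _ _ _ _ _ _ _ _ _ _ _ _ _ h hz hx hy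
  · exact isSumFourthPowers_of_regular ha hb hc hx hy hz
  · rw [← add_rotate]
    exact isSumFourthPowers_of_degenerate_regular_regular hc ha hb hz hx hy
  · rw [add_rotate]
    exact isSumFourthPowers_of_degenerate_regular_regular hb hc ha hy hz hx
  · rw [add_rotate]
    exact isSumFourthPowers_of_degenerate_degenerate hb hc (regular ha) hy hz hx
  · exact isSumFourthPowers_of_degenerate_regular_regular ha hb hc hx hy hz
  · rw [← add_rotate]
    exact isSumFourthPowers_of_degenerate_degenerate hc ha (regular hb) hz hx hy
  · exact isSumFourthPowers_of_degenerate_degenerate ha hb (regular hc) hx hy hz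
  · exact isSumFourthPowers_of_degenerate_degenerate ha hb (degenerate hc) hx hy hz

end Triangle

/-! ### Coordinates -/

section Coordinates

theorem IsSumFourthPowers.map {K R S : Type*} [Field K] [CommRing R] [Algebra K R] [CommRing S]
    [Algebra K S] {V : Submodule K R} {W : Submodule K S} {n : ℕ} {f : R} (φ : R →ₐ[K] S)
    (hφ : ∀ v ∈ V, φ v ∈ W) (hf : IsSumFourthPowers V n f) : IsSumFourthPowers W n (φ f) := by
  obtain ⟨l, hl, rfl⟩ := hf
  exact ⟨fun i => φ (l i), fun i => hφ _ (hl i), by simp⟩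

variable {K : Type*} [Field K]

theorem isHomogeneous_sum_smul_X {σ : Type*} [Fintype σ] (a : σ → K) :
    (∑ j, a j • X j : MvPolynomial σ K).IsHomogeneous 1 := by
  rw [← mem_homogeneousSubmodule]
  exact Submodule.sum_mem _ fun j _ => Submodule.smul_mem _ _ (isHomogeneous_X K j)

/-- The chain rule for polynomial substitutions. -/
theorem pderiv_aeval {σ τ : Type*} [Fintype σ] (v : σ → MvPolynomial τ K) (i : τ)
    (f : MvPolynomial σ K) :
    pderiv i (aeval v f) = ∑ j, aeval v (pderiv j f) * pderiv i (v j) := by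
  classical
  induction f using MvPolynomial.induction_on with
  | C a => simp
  | add p q hp hq => simp only [map_add, hp, hq, add_mul, Finset.sum_add_distrib]
  | mul_X p k hp =>
    simp only [map_mul, aeval_X, Derivation.leibniz, hp, smul_eq_mul, map_add, add_mul,
      Finset.sum_add_distrib, pderiv_X, Finset.mul_sum]
    congr 1
    · rw [Finset.sum_eq_single k]
      · simp
      · intro j _ hj
        simp [hj.symm]
      · simp
    · exact Finset.sum_congr rfl fun j _ => by ring

/-- A ternary quartic annihilated by `∂₀ ∂₁ ∂₂` is a combination of the twelve monomials that are
not divisible by `X 0 * X 1 * X 2`, so a sum of binary quartics. -/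
theorem exists_triangle_form [CharZero K] {g : MvPolynomial (Fin 3) K} (hg : g.IsHomogeneous 4)
    (h : pderiv 0 (pderiv 1 (pderiv 2 g)) = 0) :
    ∃ c : Fin 12 → K, g =
      binaryQuartic (c 0) (c 1) (c 2) (c 3) 0 (X 0) (X 1) +
      binaryQuartic (c 4) (c 5) (c 6) (c 7) 0 (X 1) (X 2) +
      binaryQuartic (c 8) (c 9) (c 10) (c 11) 0 (X 2) (X 0) := by
  let v : Fin 12 → MvPolynomial (Fin 3) K :=
    ![X 0 ^ 4, X 0 ^ 3 * X 1, X 0 ^ 2 * X 1 ^ 2, X 0 * X 1 ^ 3,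
      X 1 ^ 4, X 1 ^ 3 * X 2, X 1 ^ 2 * X 2 ^ 2, X 1 * X 2 ^ 3,
      X 2 ^ 4, X 2 ^ 3 * X 0, X 2 ^ 2 * X 0 ^ 2, X 2 * X 0 ^ 3]
  have hmem : g ∈ Submodule.span K (Set.range v) := by
    rw [g.as_sum]
    refine Submodule.sum_mem _ fun m hm => ?_
    have hdeg : m 0 + m 1 + m 2 = 4 := by
      have := hg (mem_support_iff.mp hm)
      simpa [Finsupp.weight_apply, Finsupp.sum_fintype, Fin.sum_univ_three] using this
    have hzero : m 0 = 0 ∨ m 1 = 0 ∨ m 2 = 0 := by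
      by_contra! hpos
      apply mem_support_iff.mp hm
      obtain ⟨m, rfl⟩ : ∃ k, m = k + Finsupp.single 0 1 + Finsupp.single 1 1 +
          Finsupp.single 2 1 := by
        refine ⟨m - Finsupp.single 0 1 - Finsupp.single 1 1 - Finsupp.single 2 1, ?_⟩
        ext i
        fin_cases i <;> simp <;> omega
      have := congrArg (coeff m) h
      simp only [coeff_pderiv, coeff_zero, mul_eq_zero] at this
      have hne (n : ℕ) : (n : K) + 1 ≠ 0 := Nat.cast_add_one_ne_zero n
      simpa only [hne, or_false] using this
    have hmon : monomial m (coeff m g) =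
        coeff m g • (X 0 ^ m 0 * X 1 ^ m 1 * X 2 ^ m 2) := by
      rw [monomial_eq, Finsupp.prod_fintype _ _ (by simp), Fin.prod_univ_three, smul_eq_C_mul]
    rw [hmon]
    refine Submodule.smul_mem _ _ (Submodule.subset_span ?_)
    generalize m 0 = a at hdeg hzero
    generalize m 1 = b at hdeg hzero
    generalize m 2 = c at hdeg hzero
    have key : ∃ i, X 0 ^ a * X 1 ^ b * X 2 ^ c = v i := by
      have ha : a ≤ 4 := by omega
      have hb : b ≤ 4 := by omega
      obtain rfl : c = 4 - a - b := by omega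
      interval_cases a <;> interval_cases b <;> first | omega | skip
      · exact ⟨8, by simp [v]⟩
      · exact ⟨7, by simp [v]⟩
      · exact ⟨6, by simp [v]⟩
      · exact ⟨5, by simp [v]⟩
      · exact ⟨4, by simp [v]⟩
      · exact ⟨9, by simp [v, mul_comm]⟩
      · exact ⟨3, by simp [v]⟩
      · exact ⟨10, by simp [v, mul_comm]⟩
      · exact ⟨2, by simp [v]⟩
      · exact ⟨11, by simp [v, mul_comm]⟩
      · exact ⟨1, by simp [v]⟩
      · exact ⟨0, by simp [v]⟩
    obtain ⟨i, hi⟩ := key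
    exact ⟨i, hi.symm⟩
  obtain ⟨c, hc⟩ := (Submodule.mem_span_range_iff_exists_fun K).mp hmem
  refine ⟨![c 0, c 1 / 4, c 2 / 6, c 3 / 4, c 4, c 5 / 4, c 6 / 6, c 7 / 4, c 8, c 9 / 4,
    c 10 / 6, c 11 / 4], ?_⟩
  have h4 (a : K) : 4 * (a / 4) = a := by field_simp
  have h6 (a : K) : 6 * (a / 6) = a := by field_simp
  rw [← hc]
  simp [Fin.sum_univ_succ, v, binaryQuartic, h4, h6]
  abel

end Coordinates

theorem mainTheorem2 {K : Type*} [Field K] [IsAlgClosed K] [CharZero K]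
    (f : MvPolynomial (Fin 3) K) (hf : f.IsHomogeneous 4)
    (x : Fin 3 → MvPolynomial (Fin 3) K) (hx : ∀ i, (x i).IsHomogeneous 1)
    (hli : LinearIndependent K x)
    (hxf : contraction (x 0 * x 1 * x 2) f = 0) :
    waringRank 4 f ≤ 7 := by
  have hA (i : Fin 3) : ∃ a : Fin 3 → K, ∑ j, a j • (X j : MvPolynomial (Fin 3) K) = x i := by
    rw [← Submodule.mem_span_range_iff_exists_fun, ← homogeneousSubmodule_one_eq_span_X]
    exact hx i
  choose A hA using hA
  have hdet : IsUnit (Matrix.of A) := by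
    rw [← Matrix.linearIndependent_rows_iff_isUnit]
    refine LinearIndependent.of_comp
      (Fintype.linearCombination K (X : Fin 3 → MvPolynomial (Fin 3) K)) ?_
    convert hli using 1
    ext1 i
    simp [Fintype.linearCombination_apply, ← hA]
  -- The substitution dual to `x`: it turns contraction by `x i` into `∂/∂(X i)`.
  let ψ : MvPolynomial (Fin 3) K →ₐ[K] MvPolynomial (Fin 3) K := aeval fun j => ∑ k, A k j • X k
  have hψ (i : Fin 3) (g : MvPolynomial (Fin 3) K) :
      pderiv i (ψ g) = ψ (contraction (x i) g) := by
    rw [pderiv_aeval, ← hA, map_sum, LinearMap.sum_apply, map_sum]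
    refine Finset.sum_congr rfl fun j _ => ?_
    have hd : pderiv i (∑ k, A k j • X k : MvPolynomial (Fin 3) K) = C (A i j) := by
      simp [pderiv_X, Pi.single_apply, smul_eq_C_mul]
    rw [hd, map_smul, LinearMap.smul_apply, contraction_X, map_smul, smul_eq_C_mul, mul_comm]
  -- The inverse substitution.
  let φ : MvPolynomial (Fin 3) K →ₐ[K] MvPolynomial (Fin 3) K :=
    aeval fun k => ∑ j, (Matrix.of A)⁻¹ j k • X j
  have hφψ : φ (ψ f) = f := by
    suffices φ.comp ψ = AlgHom.id K _ from DFunLike.congr_fun this f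
    ext1 j
    have hinv := Matrix.nonsing_inv_mul (Matrix.of A) ((Matrix.isUnit_iff_isUnit_det _).mp hdet)
    calc φ (ψ (X j)) = ∑ l, ((Matrix.of A)⁻¹ * Matrix.of A) l j • X l := by
          simp only [ψ, φ, aeval_X, map_sum, map_smul, Finset.smul_sum, Matrix.mul_apply,
            Finset.sum_smul, smul_smul, Matrix.of_apply]
          rw [Finset.sum_comm]
          simp only [mul_comm]
      _ = X j := by simp [hinv, Matrix.one_apply]
  have hhom : (ψ f).IsHomogeneous 4 := by
    exact hf.aeval (n := 1) _ fun j => isHomogeneous_sum_smul_X fun k => A k j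
  obtain ⟨c, hc⟩ := exists_triangle_form hhom (by
    rw [hψ, hψ, hψ, ← contraction_mul, ← contraction_mul, hxf, map_zero])
  have hX (i : Fin 3) : (X i : MvPolynomial (Fin 3) K) ∈ homogeneousSubmodule (Fin 3) K 1 :=
    isHomogeneous_X K i
  have hsum := isSumFourthPowers_of_triangle (c 0) (c 1) (c 2) (c 3) 0 (c 4) (c 5) (c 6) (c 7) 0
    (c 8) (c 9) (c 10) (c 11) 0 (hX 0) (hX 1) (hX 2)
  rw [← hc] at hsum
  obtain ⟨l, hl, hfl⟩ := hsum.map (W := homogeneousSubmodule (Fin 3) K 1) φ (by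
    intro v hv
    exact IsHomogeneous.aeval (hv : v.IsHomogeneous 1) (n := 1) _
      fun k => isHomogeneous_sum_smul_X fun j => (Matrix.of A)⁻¹ j k)
  rw [hφψ] at hfl
  exact sInf_le ⟨7, l, hl, hfl, rfl⟩
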